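/- Let $\mathcal A$ be a finite alphabet with $n$ letters and let $\sigma$ be a substitution over $\mathcal A$, i.e. an endomorphism of the free monoid $\mathcal A^*$ such that $\sigma(a)$ is non-empty for all $a\in\mathcal A$ and $|\sigma^k(a)|\to\infty$ for some $a$. Let $M_\sigma=(|\sigma(b)|_a)_{a,b}$ be its incidence matrix, and assume that $\sigma$ is an irreducible Pisot substitution: the dominant eigenvalue $\alpha$ of $M_\sigma$ is a Pisot number and the characteristic polynomial of $M_\sigma$ is irreducible over $\mathbb Q$. Let $K=\mathbb Q(\alpha)\subset\mathbb R$. Fix a left eigenvector $\mathbf v=(v_a)_{a\in\mathcal A}\in K^{n}$ of $M_\sigma$ for $\alpha$ with positive entries and the right eigenvector $\mathbf u\in\mathbb R^n$ for $\alpha$ with $\langle\mathbf u,\mathbf v\rangle=1$. For a word $p$ let $\mathbf P(p)=(|p|_a)_a$ and $\delta(p)=\langle\mathbf P(p),\mathbf v\rangle\in K$. Write $b\xrightarrow{p}a$ if $\sigma(b)=pas$ for some $s\in\mathcal A^*$. Let $\mathfrak p_1$ be the infinite prime of $K$ given by the inclusion $K\subset\mathbb R$, and let $K_\sigma=\prod_{\mathfrak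 p}K_{\mathfrak p}$, where $\mathfrak p$ runs over the infinite primes $\mathfrak p\ne\mathfrak p_1$ and the finite primes $\mathfrak p\mid(\alpha)$. Let $\Phi':K\to K_\sigma$ be the diagonal embedding; $K$ acts on $K_\sigma$ by multiplication. (1) For $a\in\mathcal A$ and $k\ge 0$ let $\mathbb Z^{(k)}_{\sigma,a}=\alpha^kT_\sigma^{-k}(0,a)$, where $T_\sigma^{-1}(x,a)=\bigcup_{b\xrightarrow{p}a}\{(\alpha^{-1}(x+\delta(p)),b)\}$ and second coordinates are dropped; it is the set of the sums $\sum_{i<k}\delta(p_i)\alpha^i$ over all walks $a_k\xrightarrow{p_{k-1}}\cdots\xrightarrow{p_1}a_1\xrightarrow{p_0}a$. Let $\mathbb Z_{\sigma,a}$ be the topological (Kuratowski) limit of $\mathbb Z^{(k)}_{\sigma,a}$ in $\mathbb R$ as $k\to\infty$, and $\mathcal R_\sigma(a)=\overline{\Phi'(\mathbb Z_{\sigma,a})}$. (2) Let $(\Omega_a)_{a\in\mathcal A}$ be the family of non-empty compact subsets of $K_\sigma$ that solves the graph directed iterated function system $\Omega_a=\bigcup_{b\xrightarrow{p}a}\bigl(\alpha\,\Omega_b+\Phi'(\delta(p))\bigr)$,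 $a\in\mathcal A$. (3) Let $Z=\bigcup_{k\ge0}M_\sigma^{-k}\mathbb Z^n$ and $Z_{\rm ext}=Z\times\prod_{\mathfrak p\mid(\alpha)}K_{\mathfrak p}$; put $\Psi(\mathbf x)=(\mathbf x,\langle\mathbf x,\mathbf v\rangle,\dots,\langle\mathbf x,\mathbf v\rangle)$ for $\mathbf x\in Z$, and let $M_\sigma$ act on $Z_{\rm ext}$ by $M_\sigma$ on $Z$ and by multiplication by $\alpha$ on each $K_{\mathfrak p}$. Let $E_1^*$ be the map on subsets of $\Psi(Z)\times\mathcal A$ induced by $E_1^*[\mathbf z,a]^*=\bigcup_{b\xrightarrow{p}a}\{[M_\sigma^{-1}(\mathbf z+\Psi(\mathbf P(p))),b]^*\}$. Let $\pi_{\mathbf u}(\mathbf x)=\mathbf x-\langle\mathbf x,\mathbf v\rangle\mathbf u$ be the projection of $\mathbb R^n$ along $\mathbf u$ onto the hyperplane orthogonal to $\mathbf v$, and let $$\mathcal T_\sigma(a)=\lim_{k\to\infty}(\pi_{\mathbf u}\times\mathrm{id})\bigl(M_\sigma^k (E_1^*)^k[\mathbf 0,a]^*\bigr)$$ (letters dropped),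 a non-empty compact set, with the limit taken in the Hausdorff metric. (4) Let $G:\mathbb R^n\times\prod_{\mathfrak p\mid(\alpha)}K_{\mathfrak p}\to K_\sigma$ be the linear map that sends $(\mathbf x,\mathbf y)$ to the point with $\mathfrak p$-coordinate $\sum_{i} x_i v_i\in K_{\mathfrak p}$ (with $v_i$ embedded in $K_{\mathfrak p}$) for the infinite primes $\mathfrak p\neq\mathfrak p_1$, and $y_{\mathfrak p}$ for $\mathfrak p\mid(\alpha)$. **Theorem.** The limit $\mathbb Z_{\sigma,a}$ exists and is a subset of $K$ for every $a\in\mathcal A$, the family $(\Omega_a)_{a\in\mathcal A}$ exists and is unique, the limit $\mathcal T_\sigma(a)$ exists for every $a\in\mathcal A$, and $$\mathcal R_\sigma(a)=\Omega_a=G\,\mathcal T_\sigma(a)\qquad\text{for every }a\in\mathcal A.$$ -/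

import Mathlib

open NumberField IsDedekindDomain Filter
open scoped Topology Uniformity Matrix

namespace Rauzy

/-! ### Substitutions -/

section Substitution

variable {A : Type*}

/-- A substitution is given by the images `σ a` of the letters; this is the induced endomorphism
of the free monoid of finite words. -/
def extend (σ : A → List A) (w : List A) : List A := w.flatMap σ

/-- Images of letters are non-empty and `|σ^k(a)| → ∞` for at least one letter. -/
def IsSubstitution (σ : A → List A) : Prop :=
  (∀ a, σ a ≠ []) ∧ ∃ a, Tendsto (fun k : ℕ => ((extend σ)^[k] [a]).length) atTop atTop

/-- The edge `b --p--> a` of the prefix automaton: `σ(b) = p a s` for some word `s`. -/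
def Edge (σ : A → List A) (b : A) (p : List A) (a : A) : Prop := ∃ s, σ b = p ++ a :: s

/-- The abelianisation of a word. -/
def abel [DecidableEq A] (w : List A) : A → ℕ := fun i => w.count i

/-- The incidence matrix, `M_{ab} = |σ(b)|_a`, with entries in a semiring `R`. -/
def incidence (R : Type*) [Semiring R] [DecidableEq A] (σ : A → List A) : Matrix A A R :=
  Matrix.of fun a b => ((σ b).count a : R)

/-- Pisot numbers: real algebraic integers `> 1` all of whose other conjugates have modulus
less than one. -/
def IsPisot (β : ℝ) : Prop :=
  IsIntegral ℤ β ∧ 1 < β ∧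
    ∀ z : ℂ, Polynomial.aeval z (minpoly ℚ β) = 0 → z ≠ (β : ℂ) → ‖z‖ < 1

/-- `β` is the dominant eigenvalue of the incidence matrix of `σ`. -/
def IsDominantEigenvalue [Fintype A] [DecidableEq A] (σ : A → List A) (β : ℝ) : Prop :=
  (incidence ℝ σ).charpoly.IsRoot β ∧
    ∀ z : ℂ, (incidence ℂ σ).charpoly.IsRoot z → ‖z‖ ≤ β

/-- `σ` is an irreducible Pisot substitution with Pisot root `β`. -/
structure IsIrreduciblePisot [Fintype A] [DecidableEq A] (σ : A → List A) (β : ℝ) : Prop where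
  isSubstitution : IsSubstitution σ
  isDominant : IsDominantEigenvalue σ β
  isPisot : IsPisot β
  irreducible : Irreducible (incidence ℚ σ).charpoly

end Substitution

/-! ### Limits of sets -/

section Limits

/-- `Z` is the topological (Kuratowski) limit of the sets `S k`: it is both the lower limit
(points all of whose neighbourhoods meet `S k` for all large `k`) and the upper limit
(points all of whose neighbourhoods meet `S k` for infinitely many `k`). -/
def IsTopologicalLimit {X : Type*} [TopologicalSpace X] (S : ℕ → Set X) (Z : Set X) : Prop :=
  Z = {x | ∀ U ∈ 𝓝 x, ∀ᶠ k in atTop, (U ∩ S k).Nonempty} ∧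
  Z = {x | ∀ U ∈ 𝓝 x, ∃ᶠ k in atTop, (U ∩ S k).Nonempty}

/-- The non-empty compact set `T` is the limit of the sets `S k` in the Hausdorff sense. For the
uniformity of a metric, this is convergence to zero of the Hausdorff distance of `S k` and `T`. -/
def IsHausdorffLimit {X : Type*} [UniformSpace X] (S : ℕ → Set X) (T : Set X) : Prop :=
  T.Nonempty ∧ IsCompact T ∧ ∀ U ∈ 𝓤 X, ∀ᶠ k in atTop, (S k, T) ∈ hausdorffEntourage U

end Limits

/-! ### The representation space

Here `K` is a number field with a real embedding `ι`, and `α` is an element of `K`. In the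
application `K = ℚ(α)` and `ι α` is the Pisot number. -/

section Space

variable {K : Type*} [Field K]

/-- The infinite prime `𝔭₁` given by the embedding `ι`. -/
noncomputable def primeOne (ι : K →+* ℝ) : InfinitePlace K :=
  InfinitePlace.mk (Complex.ofRealHom.comp ι)

variable [NumberField K]

/-- The finite primes `𝔭 ∣ (α)`, i.e. `v_𝔭(α) > 0`. -/
abbrev FinPrime (α : K) : Type _ := {p : HeightOneSpectrum (𝓞 K) // p.valuation K α < 1}

/-- The product of the completions `K_𝔭` over the finite primes `𝔭 ∣ (α)`. -/
abbrev FinPart (α : K) : Type _ := ∀ p : FinPrime α, p.1.adicCompletion K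

/-- The product of the completions at the infinite primes other than `𝔭₁`: the completion is
`ℝ` at a real prime and `ℂ` at a complex prime. -/
abbrev InfPart (ι : K →+* ℝ) : Type _ :=
  ({w : InfinitePlace K // w.IsReal ∧ w ≠ primeOne ι} → ℝ) ×
    ({w : InfinitePlace K // w.IsComplex} → ℂ)

/-- The representation space `K_σ`. -/
abbrev RepSpace (ι : K →+* ℝ) (α : K) : Type _ := InfPart ι × FinPart α

/-- The archimedean part of `Φ'`. -/
noncomputable def phiInf (ι : K →+* ℝ) (x : K) : InfPart ι :=
  (fun w => InfinitePlace.embedding_of_isReal w.2.1 x, fun w => w.1.embedding x)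

/-- The diagonal embedding of `K` into the finite part. -/
noncomputable def phiFin (α : K) (x : K) : FinPart α :=
  fun p => algebraMap K (p.1.adicCompletion K) x

/-- The diagonal embedding `Φ'` of `K` into `K_σ`. -/
noncomputable def phi (ι : K →+* ℝ) (α : K) (x : K) : RepSpace ι α := (phiInf ι x, phiFin α x)

end Space

section Tiles

variable {A K : Type*} [Fintype A] [DecidableEq A] [Field K]

/-- `δ(p) = ⟨P(p), v_α⟩`. -/
def delta (v : A → K) (p : List A) : K := ∑ i, (abel p i : K) * v i

/-! ### Dumont–Thomas subtiles -/

/-- The set function `T_σ⁻¹`, sending `(x, a)` to the points `(α⁻¹ (x + δ(p)), b)` with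
`b --p--> a`. -/
def dtInv (σ : A → List A) (ι : K →+* ℝ) (α : K) (v : A → K) (S : Set (ℝ × A)) : Set (ℝ × A) :=
  {q | ∃ r ∈ S, ∃ p, Edge σ q.2 p r.2 ∧ q.1 = (ι α)⁻¹ * (r.1 + ι (delta v p))}

/-- The set `α^k T_σ^{-k}(0, a)` of real numbers `∑_{i<k} δ(p_i) α^i` given by the walks of
length `k` in the prefix automaton that end at `a`. -/
def approxIntegers (σ : A → List A) (ι : K →+* ℝ) (α : K) (v : A → K) (a : A) (k : ℕ) : Set ℝ :=
  {x | ∃ q ∈ (dtInv σ ι α v)^[k] {((0 : ℝ), a)}, x = (ι α) ^ k * q.1}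

/-- `Z` is the set of `(σ, a)`-integers. -/
def IsIntegers (σ : A → List A) (ι : K →+* ℝ) (α : K) (v : A → K) (a : A) (Z : Set ℝ) : Prop :=
  IsTopologicalLimit (approxIntegers σ ι α v a) Z

variable [NumberField K]

/-- The Dumont–Thomas subtile, i.e. the closure of `Φ'(Z)`, where `Z ⊆ ι(K)` is the set of
`(σ, a)`-integers. -/
def dtSubtile (ι : K →+* ℝ) (α : K) (Z : Set ℝ) : Set (RepSpace ι α) :=
  closure (phi ι α '' {x | ι x ∈ Z})

/-! ### Dual prototiles -/

/-- The graph directed iterated function system `Θ^⋆`: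
`Θ^⋆(Ω)_a = ⋃_{b --p--> a} (α Ω_b + Φ'(δ(p)))`. -/
def thetaStar (σ : A → List A) (ι : K →+* ℝ) (α : K) (v : A → K) (Ω : A → Set (RepSpace ι α)) :
    A → Set (RepSpace ι α) :=
  fun a => {z | ∃ b p, Edge σ b p a ∧ ∃ y ∈ Ω b, z = phi ι α α * y + phi ι α (delta v p)}

/-- `Ω` is a family of non-empty compact sets with `Θ^⋆(Ω) = Ω`. -/
def IsDualPrototile (σ : A → List A) (ι : K →+* ℝ) (α : K) (v : A → K)
    (Ω : A → Set (RepSpace ι α)) : Prop :=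
  (∀ a, (Ω a).Nonempty ∧ IsCompact (Ω a)) ∧ thetaStar σ ι α v Ω = Ω

/-! ### `E₁^*`-subtiles -/

/-- The space `ℚⁿ × ∏_{𝔭 ∣ (α)} K_𝔭`, which contains `Z_ext = Z × ∏_{𝔭 ∣ (α)} K_𝔭`, where
`Z = ⋃_k M_σ^{-k} ℤⁿ`. -/
abbrev ZExt (A : Type*) (α : K) : Type _ := (A → ℚ) × FinPart α

/-- `Ψ(x) = (x, ⟨x, v_α⟩, …, ⟨x, v_α⟩)`. -/
noncomputable def psi (α : K) (v : A → K) (x : A → ℚ) : ZExt A α :=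
  (x, phiFin α (∑ i, (x i : K) * v i))

/-- The extension of `M_σ` to `Z_ext`: multiplication by `α` on the non-archimedean factors. -/
noncomputable def mExt (σ : A → List A) (α : K) (z : ZExt A α) : ZExt A α :=
  (incidence ℚ σ *ᵥ z.1, phiFin α α * z.2)

/-- The inverse of `mExt`. -/
noncomputable def mExtInv (σ : A → List A) (α : K) (z : ZExt A α) : ZExt A α :=
  ((incidence ℚ σ)⁻¹ *ᵥ z.1, phiFin α α⁻¹ * z.2)

/-- The dual map `E₁^*` acting on sets of points `[z, a]^*`: it sends `[z, a]^*` to the points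
`[M_σ⁻¹ (z + Ψ(P(p))), b]^*` with `b --p--> a`. -/
def eOneStar (σ : A → List A) (α : K) (v : A → K) (S : Set (ZExt A α × A)) :
    Set (ZExt A α × A) :=
  {q | ∃ r ∈ S, ∃ p, Edge σ q.2 p r.2 ∧
    q.1 = mExtInv σ α (r.1 + psi α v (fun i => (abel p i : ℚ)))}

/-- The space `ℝⁿ × ∏_{𝔭 ∣ (α)} K_𝔭`, which contains `ℍ_ext = ℍ × ∏_{𝔭 ∣ (α)} K_𝔭` as a closed
subset, where `ℍ` is the hyperplane orthogonal to `v_α`. -/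
abbrev RExt (A : Type*) (α : K) : Type _ := (A → ℝ) × FinPart α

/-- The map `π_u × id`, where `π_u(x) = x - ⟨x, v_α⟩ u_α` is the projection onto `ℍ` along
`u_α`. -/
noncomputable def projU (ι : K →+* ℝ) (α : K) (v : A → K) (u : A → ℝ) (z : ZExt A α) :
    RExt A α :=
  (fun i => (z.1 i : ℝ) - (∑ j, (z.1 j : ℝ) * ι (v j)) * u i, z.2)

/-- The sets `(π_u × id)(M_σ^k (E₁^*)^k [0, a]^*)`. -/
noncomputable def approxSubtile (σ : A → List A) (ι : K →+* ℝ) (α : K) (v : A → K) (u : A → ℝ)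
    (a : A) (k : ℕ) : Set (RExt A α) :=
  {y | ∃ q ∈ (eOneStar σ α v)^[k] {(0, a)}, y = projU ι α v u ((mExt σ α)^[k] q.1)}

/-- `T` is the `E₁^*`-subtile of the letter `a`. -/
def IsEOneStarSubtile (σ : A → List A) (ι : K →+* ℝ) (α : K) (v : A → K) (u : A → ℝ) (a : A)
    (T : Set (RExt A α)) : Prop :=
  IsHausdorffLimit (approxSubtile σ ι α v u a) T

/-- The linear map `G`: on the archimedean part it sends `(x_i)` to the vector with coordinates
`∑_i x_i v_i^{(w)}` for the infinite primes `w ≠ 𝔭₁`, where `v_i^{(w)}` is the image of `v_i`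
in `K_w`; on the non-archimedean part it is the identity. -/
noncomputable def gMap (ι : K →+* ℝ) (α : K) (v : A → K) (z : RExt A α) : RepSpace ι α :=
  (∑ i, z.1 i • phiInf ι (v i), z.2)

end Tiles

end Rauzy

open Rauzy

/-!
All three kinds of subtiles are limits of one family of finite sets. For a letter `a`, let `X_k(a)`
be the set of the sums `∑_{i<k} δ(p_i) α^i` over the walks of length `k` in the prefix automaton
that end at `a` (`intSums`). Splitting walks at their last edge gives
`X_{k+1}(a) = ⋃_{b --p--> a} (α X_k(b) + δ(p))` (`sums_succ`), so that the `X_k` form an orbit of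
the graph directed system that defines the dual prototiles.

*Integers.* Prolonging a walk of length `k` at its start adds `α^k δ(p)` to the sum, which is `0` if
`p` is empty and large otherwise. Below any bound the finite sets `X_k(a)` therefore decrease for
large `k`, and their topological limit `Z_a` is the set of all numbers that lie in `X_k(a)` for all
large `k` (`isIntegers_image`). By finiteness of the automaton, the sets `Z_a` are reproduced by the
graph directed system (`gifs_integers`). They are non-empty: a closed set of letters gives a left
eigenvector of a submatrix of the incidence matrix, which must be the full matrix as `α` has degree
`n` (`eq_univ_of_closed`), and hence walks with empty prefixes can be continued to any letter.

*Dual prototiles.* The normed ring `K_σ` is complete, and multiplication by `α` contracts it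
(`norm_phi_lt_one`). Two bounded orbits of a contracting graph directed system approach each other
(`exists_dist_le_of_gifs`). This gives uniqueness of the dual prototiles, total boundedness of
`Φ'(Z_a)`, so that the closures of these sets are the dual prototiles, and Hausdorff convergence of
`Φ'(X_k(a))` to them (`isDualPrototile_closure`).

*Dual map.* The approximations of the `E₁^*`-subtiles are sums over the same walks, formed in `ℚⁿ`
(`approxSubtile_eq`), and `G` maps them to `Φ'(X_k(a))` (`gMap_projU_psi`). On the hyperplane
orthogonal to `v` the archimedean part of `G` is injective because the conjugates of `v` are
eigenvectors for `n` distinct eigenvalues and so span `ℂⁿ` (`eq_zero_of_forall_embedding`). Thus `G`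
has a uniformly continuous left inverse there, and this carries the Hausdorff limits back.
-/

namespace Rauzy

/-! ### Sums over walks in the prefix automaton -/

section Walks

variable {A V W : Type*}

theorem exists_edge_iff_mem {σ : A → List A} {a b : A} : (∃ p, Edge σ b p a) ↔ a ∈ σ b := by
  constructor
  · rintro ⟨p, s, h⟩
    simp [h]
  · intro h
    obtain ⟨p, s, h⟩ := List.append_of_mem h
    exact ⟨p, s, h⟩

/-- The prefix automaton of a substitution over a finite alphabet has finitely many edges. -/
theorem finite_edge_labels (σ : A → List A) (b : A) : {p | ∃ a, Edge σ b p a}.Finite := by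
  refine (List.finite_toSet (σ b).inits).subset ?_
  rintro p ⟨a, s, h⟩
  simp only [Set.mem_ofPred_eq, List.mem_inits]
  exact ⟨a :: s, h.symm⟩

/-- The graph directed iterated function system of the prefix automaton for the maps
`y ↦ f y + d p`. -/
def gifs [Add V] (σ : A → List A) (f : V → V) (d : List A → V) (S : A → Set V) (a : A) : Set V :=
  {z | ∃ b p, Edge σ b p a ∧ ∃ y ∈ S b, z = f y + d p}

theorem gifs_mono [Add V] {σ : A → List A} {f : V → V} {d : List A → V} {S T : A → Set V}
    (h : ∀ a, S a ⊆ T a) (a : A) : gifs σ f d S a ⊆ gifs σ f d T a := by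
  rintro z ⟨b, p, e, y, hy, rfl⟩
  exact ⟨b, p, e, y, h b hy, rfl⟩

variable [AddCommGroup V] [AddCommGroup W]

/-- The pairs of a sum `∑_{i<k} f^i (d p_i)` and a letter `a_k`, over all walks
`a_k --p_{k-1}--> ⋯ --p_0--> a` of length `k` in the prefix automaton. -/
def walkSums (σ : A → List A) (f : V →+ V) (d : List A → V) (a : A) : ℕ → Set (V × A)
  | 0 => {(0, a)}
  | k + 1 => {q | ∃ r ∈ walkSums σ f d a k, ∃ p, Edge σ q.2 p r.2 ∧ q.1 = r.1 + f^[k] (d p)}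

/-- The sums `∑_{i<k} f^i (d p_i)` over the walks of length `k` that end at `a`. -/
def sums (σ : A → List A) (f : V →+ V) (d : List A → V) (k : ℕ) (a : A) : Set V :=
  Prod.fst '' walkSums σ f d a k

variable {σ : A → List A} {f : V →+ V} {d : List A → V}

/-- While `walkSums` is defined by prolonging walks at their start, walks of length `k + 1` can
also be split at their last edge. -/
theorem mem_walkSums_succ {a b : A} {k : ℕ} {y : V} :
    (y, b) ∈ walkSums σ f d a (k + 1) ↔
      ∃ c p x, Edge σ c p a ∧ (x, b) ∈ walkSums σ f d c k ∧ y = f x + d p := by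
  induction k generalizing y b with
  | zero =>
    simp only [walkSums, Set.mem_singleton_iff, Set.mem_ofPred_eq, Prod.mk.injEq]
    constructor
    · rintro ⟨r, rfl, p, e, rfl⟩
      exact ⟨b, p, 0, e, ⟨rfl, rfl⟩, by simp⟩
    · rintro ⟨c, p, x, e, ⟨rfl, rfl⟩, rfl⟩
      exact ⟨_, rfl, p, e, by simp⟩
  | succ k ih =>
    constructor
    · rintro ⟨⟨r, c'⟩, hr, p, e, hy⟩
      obtain ⟨c, p', x, e', hx, rfl⟩ := ih.1 hr
      refine ⟨c, p', x + f^[k] (d p), e', ⟨_, hx, p, e, rfl⟩, ?_⟩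
      simp only at hy
      rw [hy, map_add, Function.iterate_succ_apply']
      exact add_right_comm _ _ _
    · rintro ⟨c, p', x, e', ⟨⟨r, c'⟩, hr, p, e, hx⟩, rfl⟩
      refine ⟨(f r + d p', c'), ih.2 ⟨c, p', r, e', hr, rfl⟩, p, e, ?_⟩
      simp only at hx
      rw [hx, map_add, Function.iterate_succ_apply']
      exact add_right_comm _ _ _

theorem sums_zero (a : A) : sums σ f d 0 a = {0} := by simp [sums, walkSums]

theorem sums_succ (k : ℕ) : sums σ f d (k + 1) = gifs σ f d (sums σ f d k) := by
  ext a y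
  constructor
  · rintro ⟨⟨y, b⟩, h, rfl⟩
    obtain ⟨c, p, x, e, hx, rfl⟩ := mem_walkSums_succ.1 h
    exact ⟨c, p, e, x, ⟨_, hx, rfl⟩, rfl⟩
  · rintro ⟨c, p, e, _, ⟨⟨x, b⟩, hx, rfl⟩, rfl⟩
    exact ⟨(_, b), mem_walkSums_succ.2 ⟨c, p, x, e, hx, rfl⟩, rfl⟩

theorem finite_gifs [Finite A] {S : A → Set V} (hS : ∀ a, (S a).Finite) (a : A) :
    (gifs σ f d S a).Finite := by
  have : (⋃ b, ⋃ p ∈ {p | ∃ a, Edge σ b p a}, (fun y => f y + d p) '' S b).Finite :=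
    Set.finite_iUnion fun b => (finite_edge_labels σ b).biUnion fun p _ => (hS b).image _
  refine this.subset ?_
  rintro z ⟨b, p, e, y, hy, rfl⟩
  simp only [Set.mem_iUnion]
  exact ⟨b, p, ⟨a, e⟩, y, hy, rfl⟩

theorem finite_sums [Finite A] (k : ℕ) (a : A) : (sums σ f d k a).Finite := by
  induction k generalizing a with
  | zero => simp [sums_zero]
  | succ k ih =>
    rw [sums_succ]
    exact finite_gifs ih a

theorem gifs_image {f' : W →+ W} {d' : List A → W} (g : V →+ W) (hf : ∀ x, g (f x) = f' (g x))
    (hd : ∀ p, g (d p) = d' p) (S : A → Set V) :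
    gifs σ f' d' (fun a => g '' S a) = fun a => g '' gifs σ f d S a := by
  ext a z
  constructor
  · rintro ⟨b, p, e, _, ⟨x, hx, rfl⟩, rfl⟩
    exact ⟨_, ⟨b, p, e, x, hx, rfl⟩, by rw [map_add, hf, hd]⟩
  · rintro ⟨_, ⟨b, p, e, x, hx, rfl⟩, rfl⟩
    exact ⟨b, p, e, g x, ⟨x, hx, rfl⟩, by rw [map_add, hf, hd]⟩

/-- Walk sums are natural in the data `(V, f, d)`. -/
theorem sums_map {f' : W →+ W} {d' : List A → W} (g : V →+ W) (hf : ∀ x, g (f x) = f' (g x))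
    (hd : ∀ p, g (d p) = d' p) (k : ℕ) : sums σ f' d' k = fun a => g '' sums σ f d k a := by
  induction k with
  | zero => funext a; simp [sums_zero]
  | succ k ih => rw [sums_succ, sums_succ, ih, gifs_image g hf hd]

/-- A set-valued map that renormalises by `mInv` in every step produces, after undoing the
renormalisation `k` times, the image of the walk sums of length `k`. -/
theorem image_iterate_eq_image_walkSums {m : W →+ W} {mInv : W → W} (hm : ∀ y, m (mInv y) = y)
    (e : V →+ W) (he : ∀ x, e (f x) = m (e x)) {step : Set (W × A) → Set (W × A)}
    (hstep : ∀ S, step S =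
      {q | ∃ r ∈ S, ∃ p, Edge σ q.2 p r.2 ∧ q.1 = mInv (r.1 + e (d p))}) (a : A) (k : ℕ) :
    (fun q : W × A => (m^[k] q.1, q.2)) '' (step^[k] {(0, a)}) =
      (fun r : V × A => (e r.1, r.2)) '' walkSums σ f d a k := by
  have hsemi : ∀ (k : ℕ) (x : V), e (f^[k] x) = m^[k] (e x) := fun k x =>
    (Function.Semiconj.iterate_right (f := e) he k).eq x
  induction k with
  | zero => simp [walkSums]
  | succ k ih =>
    rw [Function.iterate_succ_apply', hstep]
    ext ⟨y, b⟩
    constructor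
    · rintro ⟨⟨_, b⟩, ⟨⟨r, c⟩, hr, p, hp, rfl⟩, hq⟩
      obtain ⟨⟨x, c'⟩, hx, hxr⟩ := ih.subset ⟨_, hr, rfl⟩
      simp only [Prod.mk.injEq] at hxr hq
      obtain ⟨hxr, rfl⟩ := hxr
      obtain ⟨hq, rfl⟩ := hq
      refine ⟨(x + f^[k] (d p), b), ⟨_, hx, p, hp, rfl⟩, ?_⟩
      simp only [Prod.mk.injEq, and_true]
      rw [← hq, Function.iterate_succ_apply, hm, iterate_map_add, map_add, hsemi, hxr]
    · rintro ⟨⟨_, b⟩, ⟨⟨x, c⟩, hx, p, hp, rfl⟩, hq⟩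
      obtain ⟨⟨r, c'⟩, hr, hxr⟩ := ih.superset ⟨_, hx, rfl⟩
      simp only [Prod.mk.injEq] at hxr hq
      obtain ⟨hxr, rfl⟩ := hxr
      obtain ⟨hq, rfl⟩ := hq
      refine ⟨(mInv (r + e (d p)), b), ⟨_, hr, p, hp, rfl⟩, ?_⟩
      simp only [Prod.mk.injEq, and_true]
      rw [← hq, Function.iterate_succ_apply, hm, iterate_map_add, map_add, hsemi, hxr]

/-- Prolonging a walk by edges with empty prefix does not change its sum. -/
theorem walkSums_prolong (hd : d [] = 0) {g : A → A} (hg : ∀ b, Edge σ b [] (g b)) {a : A} {l : ℕ}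
    {x : V} (j : ℕ) (b : A) (h : (x, g^[j] b) ∈ walkSums σ f d a l) :
    (x, b) ∈ walkSums σ f d a (l + j) := by
  induction j generalizing b with
  | zero => exact h
  | succ j ih =>
    exact ⟨(x, g b), ih (g b) h, [], hg b, by simp [hd, iterate_map_zero]⟩

end Walks

/-! ### Contracting graph directed systems -/

section Contraction

variable {A X : Type*} [SeminormedAddCommGroup X] {σ : A → List A} {f : X → X} {d : List A → X}
  {c D : ℝ}

/-- Two orbits of the graph directed system approach each other at the rate of the contraction. -/
theorem exists_dist_le_of_gifs (hc : 0 ≤ c) (hf : ∀ x y, dist (f x) (f y) ≤ c * dist x y)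
    {S T : ℕ → A → Set X} (hS : ∀ k a, S (k + 1) a ⊆ gifs σ f d (S k) a)
    (hT : ∀ k a, gifs σ f d (T k) a ⊆ T (k + 1) a)
    (h0 : ∀ a, ∀ y ∈ S 0 a, ∃ t ∈ T 0 a, dist y t ≤ D) (k : ℕ) (a : A) :
    ∀ y ∈ S k a, ∃ t ∈ T k a, dist y t ≤ c ^ k * D := by
  induction k generalizing a with
  | zero => simpa using h0 a
  | succ k ih =>
    intro z hz
    obtain ⟨b, p, e, y, hy, rfl⟩ := hS k a hz
    obtain ⟨t, ht, hyt⟩ := ih b y hy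
    refine ⟨f t + d p, hT k a ⟨b, p, e, t, ht, rfl⟩, ?_⟩
    rw [dist_add_right, pow_succ', mul_assoc]
    exact (hf y t).trans (mul_le_mul_of_nonneg_left hyt hc)

/-- A uniform bound for the distances between the points of two families of bounded sets. -/
theorem exists_forall_dist_le [Finite A] {S T : A → Set X}
    (hS : ∀ a, Bornology.IsBounded (S a)) (hT : ∀ a, Bornology.IsBounded (T a)) :
    ∃ D, ∀ a b, ∀ y ∈ S a, ∀ t ∈ T b, dist y t ≤ D := by
  obtain ⟨D, hD⟩ := Metric.isBounded_iff.1
    ((Bornology.isBounded_iUnion.2 hS).union (Bornology.isBounded_iUnion.2 hT))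
  exact ⟨D, fun a b y hy t ht => hD (Or.inl (Set.mem_iUnion.2 ⟨a, hy⟩))
    (Or.inr (Set.mem_iUnion.2 ⟨b, ht⟩))⟩

theorem subset_closure_of_gifs [Finite A] (hc : 0 ≤ c) (hc1 : c < 1)
    (hf : ∀ x y, dist (f x) (f y) ≤ c * dist x y) {S T : A → Set X}
    (hSb : ∀ a, Bornology.IsBounded (S a)) (hTb : ∀ a, Bornology.IsBounded (T a))
    (hTn : ∀ a, (T a).Nonempty) (hS : ∀ a, S a ⊆ gifs σ f d S a)
    (hT : ∀ a, gifs σ f d T a ⊆ T a) (a : A) : S a ⊆ closure (T a) := by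
  obtain ⟨D, hD⟩ := exists_forall_dist_le hSb hTb
  intro y hy
  rw [Metric.mem_closure_iff]
  intro ε hε
  have hlim : Tendsto (fun k : ℕ => c ^ k * D) atTop (𝓝 0) := by
    simpa using (tendsto_pow_atTop_nhds_zero_of_lt_one hc hc1).mul_const D
  obtain ⟨k, hk⟩ := (hlim.eventually_lt_const hε).exists
  obtain ⟨t, ht, hyt⟩ := exists_dist_le_of_gifs (D := D) hc hf (S := fun _ => S) (T := fun _ => T)
    (fun _ => hS) (fun _ => hT)
    (fun a y hy => ⟨_, (hTn a).some_mem, hD a a y hy _ (hTn a).some_mem⟩) k a y hy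
  exact ⟨t, ht, hyt.trans_lt hk⟩

/-- The solution of a contracting graph directed system in non-empty compact sets is unique. -/
theorem gifs_fixed_unique [Finite A] [T2Space X] (hc : 0 ≤ c) (hc1 : c < 1)
    (hf : ∀ x y, dist (f x) (f y) ≤ c * dist x y) {S T : A → Set X}
    (hSk : ∀ a, (S a).Nonempty ∧ IsCompact (S a)) (hTk : ∀ a, (T a).Nonempty ∧ IsCompact (T a))
    (hS : gifs σ f d S = S) (hT : gifs σ f d T = T) : S = T := by
  funext a
  refine Set.Subset.antisymm ?_ ?_
  · have := subset_closure_of_gifs hc hc1 hf (fun a => (hSk a).2.isBounded)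
      (fun a => (hTk a).2.isBounded) (fun a => (hTk a).1) (fun a => (congrFun hS a).ge)
      (fun a => (congrFun hT a).le) a
    rwa [(hTk a).2.isClosed.closure_eq] at this
  · have := subset_closure_of_gifs hc hc1 hf (fun a => (hTk a).2.isBounded)
      (fun a => (hSk a).2.isBounded) (fun a => (hSk a).1) (fun a => (congrFun hT a).ge)
      (fun a => (congrFun hS a).le) a
    rwa [(hSk a).2.isClosed.closure_eq] at this

/-- The walk sums of a contraction stay in a ball that does not depend on the length. -/
theorem exists_forall_sums_norm_le [Finite A] {f : X →+ X} (hc : 0 ≤ c) (hc1 : c < 1)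
    (hf : ∀ x, ‖f x‖ ≤ c * ‖x‖) : ∃ B, ∀ k a, ∀ y ∈ sums σ f d k a, ‖y‖ ≤ B := by
  have hfin : (⋃ b, {p | ∃ a, Edge σ b p a}).Finite :=
    Set.finite_iUnion fun b => finite_edge_labels σ b
  obtain ⟨D, hD⟩ := (hfin.image fun p => ‖d p‖).bddAbove
  have hD' : ∀ b p a, Edge σ b p a → ‖d p‖ ≤ max D 0 := fun b p a e =>
    (hD ⟨p, Set.mem_iUnion.2 ⟨b, a, e⟩, rfl⟩).trans (le_max_left _ _)
  have hpos : 0 < 1 - c := sub_pos.2 hc1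
  -- `B = D / (1 - c)` solves `c * B + D = B`
  refine ⟨max D 0 / (1 - c), fun k => ?_⟩
  induction k with
  | zero =>
    intro a y hy
    rw [sums_zero, Set.mem_singleton_iff] at hy
    rw [hy, norm_zero]
    exact div_nonneg (le_max_right _ _) hpos.le
  | succ k ih =>
    intro a z hz
    rw [sums_succ] at hz
    obtain ⟨b, p, e, y, hy, rfl⟩ := hz
    calc ‖f y + d p‖ ≤ c * ‖y‖ + max D 0 :=
          (norm_add_le _ _).trans (add_le_add (hf y) (hD' b p a e))
      _ ≤ c * (max D 0 / (1 - c)) + max D 0 :=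
          add_le_add_left (mul_le_mul_of_nonneg_left (ih b y hy) hc) _
      _ = max D 0 / (1 - c) := by field_simp; ring

/-- A bounded family that the graph directed system reproduces is totally bounded: it is close to
the finite sets of walk sums. -/
theorem totallyBounded_of_gifs [Finite A] {f : X →+ X} (hc : 0 ≤ c) (hc1 : c < 1)
    (hf : ∀ x, ‖f x‖ ≤ c * ‖x‖) {S : A → Set X} (hSb : ∀ a, Bornology.IsBounded (S a))
    (hS : gifs σ f d S = S) (a : A) : TotallyBounded (S a) := by
  have hf' : ∀ x y, dist (f x) (f y) ≤ c * dist x y := fun x y => by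
    rw [dist_eq_norm, dist_eq_norm, ← map_sub]
    exact hf _
  obtain ⟨D, hD⟩ := exists_forall_dist_le (T := fun _ : A => ({0} : Set X)) hSb
    (fun _ => Bornology.isBounded_singleton)
  rw [Metric.totallyBounded_iff]
  intro ε hε
  have hlim : Tendsto (fun k : ℕ => c ^ k * D) atTop (𝓝 0) := by
    simpa using (tendsto_pow_atTop_nhds_zero_of_lt_one hc hc1).mul_const D
  obtain ⟨k, hk⟩ := (hlim.eventually_lt_const hε).exists
  refine ⟨sums σ f d k a, finite_sums k a, fun y hy => ?_⟩
  obtain ⟨t, ht, hyt⟩ := exists_dist_le_of_gifs (D := D) hc hf' (S := fun _ => S)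
    (T := fun k => sums σ f d k) (fun _ a => (congrFun hS a).ge)
    (fun k a => (congrFun (sums_succ k) a).ge)
    (fun a y hy => ⟨0, by simp [sums_zero], hD a a y hy 0 rfl⟩) k a y hy
  simp only [Set.mem_iUnion]
  exact ⟨t, ht, Metric.mem_ball.2 (hyt.trans_lt hk)⟩

/-- The closures of a bounded family reproduced by a contracting graph directed system solve the
system in compact sets. -/
theorem gifs_closure [Finite A] [T2Space X] [CompleteSpace X] {f : X →+ X} (hc : 0 ≤ c)
    (hc1 : c < 1) (hf : ∀ x, ‖f x‖ ≤ c * ‖x‖) {S : A → Set X}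
    (hSb : ∀ a, Bornology.IsBounded (S a)) (hS : gifs σ f d S = S) :
    (∀ a, IsCompact (closure (S a))) ∧
      gifs σ f d (fun a => closure (S a)) = fun a => closure (S a) := by
  have hcomp : ∀ a, IsCompact (closure (S a)) := fun a =>
    (totallyBounded_of_gifs hc hc1 hf hSb hS a).closure.isCompact_of_isClosed
      isClosed_closure
  have hcont : Continuous f := AddMonoidHomClass.continuous_of_bound f c hf
  refine ⟨hcomp, funext fun a => Set.Subset.antisymm ?_ ?_⟩
  · rintro z ⟨b, p, e, y, hy, rfl⟩
    have hcont' : Continuous fun y => f y + d p := hcont.add continuous_const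
    refine map_mem_closure (f := fun y => f y + d p) hcont' hy fun x hx => ?_
    rw [← hS]
    exact ⟨b, p, e, x, hx, rfl⟩
  · have hK : IsCompact (gifs σ f d (fun a => closure (S a)) a) := by
      have hEq : gifs σ f d (fun a => closure (S a)) a =
          ⋃ b, ⋃ p ∈ {p | Edge σ b p a}, (fun y => f y + d p) '' closure (S b) := by
        ext z
        simp only [gifs, Set.mem_iUnion, Set.mem_image, Set.mem_ofPred_eq, exists_prop]
        simp only [eq_comm]
      rw [hEq]
      exact isCompact_iUnion fun b =>
        ((finite_edge_labels σ b).subset fun p e => ⟨a, e⟩).isCompact_biUnion fun p _ =>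
          (hcomp b).image (hcont.add continuous_const)
    refine closure_minimal ?_ hK.isClosed
    conv_lhs => rw [← hS]
    exact gifs_mono (fun a => subset_closure) a

/-- Walk sums of a contraction converge, in the Hausdorff sense, to the solution of the graph
directed system. -/
theorem isHausdorffLimit_sums [Finite A] {f : X →+ X} (hc : 0 ≤ c) (hc1 : c < 1)
    (hf : ∀ x, ‖f x‖ ≤ c * ‖x‖) {T : A → Set X} (hTk : ∀ a, (T a).Nonempty ∧ IsCompact (T a))
    (hT : gifs σ f d T = T) (a : A) : IsHausdorffLimit (fun k => sums σ f d k a) (T a) := by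
  have hf' : ∀ x y, dist (f x) (f y) ≤ c * dist x y := fun x y => by
    rw [dist_eq_norm, dist_eq_norm, ← map_sub]
    exact hf _
  obtain ⟨D, hD⟩ := exists_forall_dist_le (S := T) (T := fun _ : A => ({0} : Set X))
    (fun a => (hTk a).2.isBounded) (fun _ => Bornology.isBounded_singleton)
  refine ⟨(hTk a).1, (hTk a).2, fun U hU => ?_⟩
  obtain ⟨ε, hε, hεU⟩ := Metric.mem_uniformity_dist.1 hU
  have hlim : Tendsto (fun k : ℕ => c ^ k * D) atTop (𝓝 0) := by
    simpa using (tendsto_pow_atTop_nhds_zero_of_lt_one hc hc1).mul_const D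
  filter_upwards [hlim.eventually_lt_const hε] with k hk
  constructor
  · intro y hy
    obtain ⟨t, ht, hyt⟩ := exists_dist_le_of_gifs (D := D) hc hf' (S := fun k => sums σ f d k)
      (T := fun _ => T) (fun k a => (congrFun (sums_succ k) a).le)
      (fun _ a => (congrFun hT a).le)
      (fun a y hy => by
        rw [sums_zero, Set.mem_singleton_iff] at hy
        obtain ⟨t, ht⟩ := (hTk a).1
        exact ⟨t, ht, by rw [hy, dist_comm]; exact hD a a t ht 0 rfl⟩) k a y hy
    exact ⟨t, ht, hεU (hyt.trans_lt hk)⟩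
  · intro y hy
    obtain ⟨t, ht, hyt⟩ := exists_dist_le_of_gifs (D := D) hc hf' (S := fun _ => T)
      (T := fun k => sums σ f d k) (fun _ a => (congrFun hT a).ge)
      (fun k a => (congrFun (sums_succ k) a).ge)
      (fun a y hy => ⟨0, by simp [sums_zero], hD a a y hy 0 rfl⟩) k a y hy
    exact ⟨t, ht, hεU (by rw [dist_comm]; exact hyt.trans_lt hk)⟩

end Contraction

/-! ### Limits of sets -/

section Limits

theorem IsHausdorffLimit.unique {X : Type*} [UniformSpace X] [T2Space X] {S : ℕ → Set X}
    {T T' : Set X} (h : IsHausdorffLimit S T) (h' : IsHausdorffLimit S T') : T = T' := by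
  have key : ∀ {T T' : Set X}, IsHausdorffLimit S T → IsHausdorffLimit S T' → T ⊆ T' := by
    intro T T' h h' x hx
    rw [← h'.2.1.isClosed.closure_eq, mem_closure_iff_nhds]
    intro N hN
    obtain ⟨U, hU, hUN⟩ := UniformSpace.mem_nhds_iff.1 hN
    obtain ⟨W, hW, hWs, hWU⟩ := comp_symm_mem_uniformity_sets hU
    obtain ⟨k, h1, h2⟩ := ((h.2.2 W hW).and (h'.2.2 W hW)).exists
    obtain ⟨s, hs, hsx⟩ := h1.2 hx
    obtain ⟨t, ht, hst⟩ := h2.1 hs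
    exact ⟨t, hUN (hWU ⟨s, SetRel.symm W hsx, hst⟩), ht⟩
  exact (key h h').antisymm (key h' h)

theorem IsHausdorffLimit.image {X Y : Type*} [UniformSpace X] [UniformSpace Y] {S : ℕ → Set X}
    {T : Set X} (h : IsHausdorffLimit S T) {g : X → Y} (hg : UniformContinuous g) :
    IsHausdorffLimit (fun k => g '' S k) (g '' T) := by
  refine ⟨h.1.image g, h.2.1.image hg.continuous, fun U hU => ?_⟩
  filter_upwards [h.2.2 _ (hg hU)] with k hk
  constructor
  · rintro _ ⟨s, hs, rfl⟩
    obtain ⟨t, ht, hst⟩ := hk.1 hs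
    exact ⟨g t, ⟨t, ht, rfl⟩, hst⟩
  · rintro _ ⟨t, ht, rfl⟩
    obtain ⟨s, hs, hst⟩ := hk.2 ht
    exact ⟨g s, ⟨s, hs, rfl⟩, hst⟩

/-- Finite sets of reals that eventually decrease below every bound have a topological limit, and
a point that lies in infinitely many of them lies in all but finitely many. -/
theorem isTopologicalLimit_eventually {S : ℕ → Set ℝ} (hfin : ∀ k, (S k).Finite)
    (hdec : ∀ R : ℝ, ∀ᶠ k in atTop, ∀ x ∈ S (k + 1), x < R → x ∈ S k) :
    IsTopologicalLimit S {x | ∀ᶠ k in atTop, x ∈ S k} := by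
  have hlow : {x | ∀ᶠ k in atTop, x ∈ S k} ⊆
      {x | ∀ U ∈ 𝓝 x, ∀ᶠ k in atTop, (U ∩ S k).Nonempty} := fun x hx U hU =>
    hx.mono fun k hk => ⟨x, mem_of_mem_nhds hU, hk⟩
  have hmid : {x : ℝ | ∀ U ∈ 𝓝 x, ∀ᶠ k in atTop, (U ∩ S k).Nonempty} ⊆
      {x | ∀ U ∈ 𝓝 x, ∃ᶠ k in atTop, (U ∩ S k).Nonempty} := fun x hx U hU => (hx U hU).frequently
  have hup : {x : ℝ | ∀ U ∈ 𝓝 x, ∃ᶠ k in atTop, (U ∩ S k).Nonempty} ⊆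
      {x | ∀ᶠ k in atTop, x ∈ S k} := by
    intro x hx
    obtain ⟨k₀, hk₀⟩ := eventually_atTop.1 (hdec (x + 1))
    have hanti : ∀ k ≥ k₀, ∀ j ≥ k, ∀ y ∈ S j, y < x + 1 → y ∈ S k := by
      intro k hk j hj
      induction j, hj using Nat.le_induction with
      | base => exact fun y hy _ => hy
      | succ j hj ih => exact fun y hy hyx => ih y (hk₀ j (hk.trans hj) y hy hyx) hyx
    by_contra hcon
    obtain ⟨k₁, hk₁, hx₁⟩ : ∃ k₁ ≥ k₀, x ∉ S k₁ := by
      by_contra! h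
      exact hcon (eventually_atTop.2 ⟨k₀, h⟩)
    -- below `x + 1` all later sets are contained in the finite set `S k₁`, which misses `x`
    have hU : (Set.Iio (x + 1) ∩ (S k₁)ᶜ) ∈ 𝓝 x :=
      inter_mem (Iio_mem_nhds (by linarith)) ((hfin k₁).isClosed.isOpen_compl.mem_nhds hx₁)
    obtain ⟨j, hj, y, ⟨hy1, hy2⟩, hy3⟩ := (frequently_atTop.1 (hx _ hU)) k₁
    exact hy2 (hanti k₁ hk₁ j hj y hy3 hy1)
  exact ⟨hlow.antisymm (hmid.trans hup), (hlow.trans hmid).antisymm hup⟩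

end Limits


/-! ### The incidence matrix and the eigenvalue -/

section Incidence

variable {A : Type*} [Fintype A] [DecidableEq A] {K : Type*} [Field K] {σ : A → List A} {α : K}
  {v : A → K}

omit [Fintype A] in
theorem incidence_map {R S : Type*} [Semiring R] [Semiring S] (τ : R →+* S) (σ : A → List A) :
    (incidence R σ).map τ = incidence S σ := by
  ext a b
  simp [incidence]

/-- Conjugating a left eigenvector gives a left eigenvector for the conjugate eigenvalue. -/
theorem vecMul_incidence_map {L : Type*} [Field L] (hv : v ᵥ* incidence K σ = α • v)
    (τ : K →+* L) : (fun i => τ (v i)) ᵥ* incidence L σ = τ α • fun i => τ (v i) := by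
  ext b
  have := congrArg τ (congrFun hv b)
  rw [RingHom.map_vecMul, incidence_map] at this
  simpa [Function.comp_def] using this

/-- The degree of an eigenvalue is at most the size of a rational matrix. -/
theorem natDegree_minpoly_le_card [Algebra ℚ K] {B : Type*} [Fintype B] [DecidableEq B]
    (N : Matrix B B ℚ) {w : B → K} (hw : w ≠ 0) (hN : w ᵥ* N.map (algebraMap ℚ K) = α • w) :
    Polynomial.aeval α N.charpoly = 0 ∧ (minpoly ℚ α).natDegree ≤ Fintype.card B := by
  have h0 : Polynomial.aeval α N.charpoly = 0 := by
    rw [Polynomial.aeval_def, ← Polynomial.eval_map, ← Matrix.charpoly_map, Matrix.eval_charpoly,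
      ← Matrix.exists_vecMul_eq_zero_iff]
    refine ⟨w, hw, ?_⟩
    rw [Matrix.vecMul_sub, hN]
    simp [Matrix.scalar_apply, ← Matrix.smul_one_eq_diagonal, Matrix.vecMul_smul]
  refine ⟨h0, ?_⟩
  rw [← N.charpoly_natDegree_eq_dim]
  exact Polynomial.natDegree_le_of_dvd (minpoly.dvd ℚ α h0) N.charpoly_monic.ne_zero

variable [Algebra ℚ K] (hirr : Irreducible (incidence ℚ σ).charpoly)
  (hv : v ᵥ* incidence K σ = α • v)

include hirr in
theorem nonempty_of_irreducible_charpoly : Nonempty A := by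
  by_contra h
  rw [not_nonempty_iff] at h
  refine hirr.not_isUnit ?_
  simp [Matrix.charpoly, Matrix.det_isEmpty]

include hirr hv in
theorem minpoly_eq_charpoly (hv0 : v ≠ 0) : minpoly ℚ α = (incidence ℚ σ).charpoly := by
  symm
  refine minpoly.eq_of_irreducible_of_monic hirr ?_ (Matrix.charpoly_monic _)
  exact (natDegree_minpoly_le_card _ hv0 (by rw [incidence_map, hv])).1

include hirr hv in
theorem natDegree_minpoly_eq_card (hv0 : v ≠ 0) :
    (minpoly ℚ α).natDegree = Fintype.card A := by
  rw [minpoly_eq_charpoly hirr hv hv0, Matrix.charpoly_natDegree_eq_dim]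

include hirr hv in
theorem incidence_det_ne_zero (hv0 : v ≠ 0) (hα : α ≠ 0) : (incidence ℚ σ).det ≠ 0 := by
  rw [Matrix.det_eq_sign_charpoly_coeff, ← minpoly_eq_charpoly hirr hv hv0]
  refine mul_ne_zero (pow_ne_zero _ (by norm_num)) (minpoly.coeff_zero_ne_zero ?_ hα)
  refine ⟨_, Matrix.charpoly_monic (incidence ℚ σ), ?_⟩
  exact (natDegree_minpoly_le_card _ hv0 (by rw [incidence_map, hv])).1

include hirr hv in
/-- A non-empty set of letters that is closed under passing from `b` to the letters of `σ b` is
everything: the restriction of `v` to this set is a left eigenvector of a submatrix, the size of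
which is thus at least the degree of `α`. -/
theorem eq_univ_of_closed (hv0 : ∀ i, v i ≠ 0) {S : Set A} (hS : S.Nonempty)
    (hcl : ∀ b ∈ S, ∀ a ∈ σ b, a ∈ S) : S = Set.univ := by
  classical
  obtain ⟨c, hc⟩ := hS
  have hv0' : v ≠ 0 := fun h => hv0 c (by rw [h]; rfl)
  have hcard := (natDegree_minpoly_le_card (α := α)
    ((incidence ℚ σ).submatrix (Subtype.val : S → A) Subtype.val) (w := fun i : S => v i)
    (fun h => hv0 c (congrFun h ⟨c, hc⟩)) ?_).2
  · rw [natDegree_minpoly_eq_card hirr hv hv0'] at hcard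
    rw [← Set.toFinset_eq_univ, ← Finset.card_eq_iff_eq_univ, Set.toFinset_card]
    exact le_antisymm (Fintype.card_subtype_le _) hcard
  · ext ⟨b, hb⟩
    have h := congrFun hv b
    rw [Pi.smul_apply] at h ⊢
    rw [← h]
    refine Fintype.sum_of_injective Subtype.val Subtype.val_injective _ _ (fun a ha => ?_)
      fun a => by simp [incidence]
    -- a letter outside `S` does not occur in `σ b`
    have : a ∉ σ b := fun hab => ha ⟨⟨a, hcl b hb a hab⟩, rfl⟩
    simp [incidence, List.count_eq_zero.2 this]

end Incidence

/-! ### The embeddings of `K = ℚ(α)` -/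

section Embeddings

variable {A : Type*} [Fintype A] [DecidableEq A] {K : Type*} [Field K] [NumberField K]
  {σ : A → List A} {ι : K →+* ℝ} {α : K} {v : A → K}

theorem embedding_apply_injective (hK : IntermediateField.adjoin ℚ {α} = ⊤) :
    Function.Injective fun τ : K →+* ℂ => τ α := by
  intro τ τ' h
  have := (Field.primitive_element_iff_algHom_eq_of_eval' ℚ ℂ
    (fun x => IsAlgClosed.splits _) α).1 hK
    (a₁ := τ.toRatAlgHom) (a₂ := τ'.toRatAlgHom) h
  ext x
  exact DFunLike.congr_fun this x

theorem norm_embedding_lt_one (hP : IsPisot (ι α)) (hK : IntermediateField.adjoin ℚ {α} = ⊤)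
    {τ : K →+* ℂ} (hτ : τ ≠ Complex.ofRealHom.comp ι) : ‖τ α‖ < 1 := by
  refine hP.2.2 _ ?_ fun h => hτ (embedding_apply_injective hK h)
  have h1 : minpoly ℚ (ι α) = minpoly ℚ α := minpoly.algHom_eq ι.toRatAlgHom ι.injective α
  rw [h1]
  have := Polynomial.aeval_algHom_apply τ.toRatAlgHom α (minpoly ℚ α)
  rw [minpoly.aeval, map_zero] at this
  exact this

/-- A complex vector that is orthogonal to all conjugates of `v` vanishes, since these are
eigenvectors for distinct eigenvalues. -/
theorem eq_zero_of_forall_embedding (hirr : Irreducible (incidence ℚ σ).charpoly)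
    (hK : IntermediateField.adjoin ℚ {α} = ⊤) (hv : v ᵥ* incidence K σ = α • v) (hv0 : v ≠ 0)
    {x : A → ℂ} (hx : ∀ τ : K →+* ℂ, ∑ i, x i * τ (v i) = 0) : x = 0 := by
  classical
  have hlin : LinearIndependent ℂ fun (τ : K →+* ℂ) (i : A) => τ (v i) := by
    refine Module.End.eigenvectors_linearIndependent' (Matrix.vecMulLinear (incidence ℂ σ))
      (fun τ : K →+* ℂ => τ α) (embedding_apply_injective hK) _ fun τ => ⟨?_, fun h => hv0 ?_⟩
    · rw [Module.End.mem_eigenspace_iff]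
      exact vecMul_incidence_map hv τ
    · ext i
      exact (map_eq_zero τ).1 (congrFun h i)
  have hspan := hlin.span_eq_top_of_card_eq_finrank' (by
    rw [Embeddings.card, Module.finrank_fintype_fun_eq_card,
      ← (Field.primitive_element_iff_minpoly_natDegree_eq ℚ α).1 hK,
      natDegree_minpoly_eq_card hirr hv hv0])
  have hker : ⊤ ≤ LinearMap.ker (Fintype.linearCombination ℂ x) := by
    rw [← hspan, Submodule.span_le]
    rintro _ ⟨τ, rfl⟩
    simpa [Fintype.linearCombination_apply, mul_comm] using hx τ
  ext i
  have := hker (Submodule.mem_top (x := Pi.single i 1))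
  simpa [Fintype.linearCombination_apply_single] using this

omit [NumberField K] in
/-- Left and right eigenvectors for different eigenvalues are orthogonal. -/
theorem sum_mul_embedding_eq_zero {L : Type*} [Field L] (j : ℝ →+* L) {u : A → ℝ}
    (hv : v ᵥ* incidence K σ = α • v) (hu : incidence ℝ σ *ᵥ u = ι α • u) {τ : K →+* L}
    (hτ : τ α ≠ j (ι α)) : ∑ i, j (u i) * τ (v i) = 0 := by
  have h1 := vecMul_incidence_map hv τ
  have h2 : incidence L σ *ᵥ (fun i => j (u i)) = j (ι α) • fun i => j (u i) := by
    ext b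
    have := congrArg j (congrFun hu b)
    rw [RingHom.map_mulVec, incidence_map] at this
    simpa [Function.comp_def] using this
  have h3 := Matrix.dotProduct_mulVec (fun i => τ (v i)) (incidence L σ) (fun i => j (u i))
  rw [h1, h2, dotProduct_smul, smul_dotProduct, smul_eq_mul, smul_eq_mul] at h3
  have h4 : (fun i => τ (v i)) ⬝ᵥ (fun i => j (u i)) = 0 := by
    by_contra h
    exact hτ (mul_right_cancel₀ h h3).symm
  rw [← h4]
  exact Finset.sum_congr rfl fun i _ => mul_comm _ _

end Embeddings

/-! ### The representation space -/

section Space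

variable {K : Type*} [Field K] [NumberField K] {ι : K →+* ℝ} {α : K}

theorem finite_finPrime (hα : α ≠ 0) : Finite (FinPrime α) := by
  refine ((HeightOneSpectrum.Support.finite (𝓞 K) α⁻¹).subset fun p hp => ?_).to_subtype
  have h0 : 0 < p.valuation K α := by simpa [zero_lt_iff] using hα
  change 1 < p.valuation K α⁻¹
  rw [map_inv₀]
  exact (one_lt_inv₀ h0).2 hp

/-- The diagonal embedding `Φ'` as a ring homomorphism. -/
noncomputable def phiHom (ι : K →+* ℝ) (α : K) : K →+* RepSpace ι α :=
  ((RingHom.pi fun w : {w : InfinitePlace K // w.IsReal ∧ w ≠ primeOne ι} =>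
      InfinitePlace.embedding_of_isReal w.2.1).prod
    (RingHom.pi fun w : {w : InfinitePlace K // w.IsComplex} => w.1.embedding)).prod
  (RingHom.pi fun p : FinPrime α => algebraMap K (p.1.adicCompletion K))

omit [NumberField K] in
theorem embedding_ne_of_ne_primeOne {w : InfinitePlace K} (hw : w ≠ primeOne ι) :
    w.embedding ≠ Complex.ofRealHom.comp ι := fun h => hw (by
  rw [primeOne, ← h, InfinitePlace.mk_embedding])

omit [NumberField K] in
theorem primeOne_isReal : (primeOne ι).IsReal := by
  refine ⟨Complex.ofRealHom.comp ι, ?_, rfl⟩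
  ext x
  simp

omit [NumberField K] in
theorem ne_primeOne_of_isComplex {w : InfinitePlace K} (hw : w.IsComplex) : w ≠ primeOne ι :=
  fun h => InfinitePlace.not_isReal_iff_isComplex.2 hw (h ▸ primeOne_isReal)

omit [NumberField K] in
/-- The embedding `ι` is real, so no other embedding gives the place `𝔭₁`. -/
theorem embedding_mk_ne {τ : K →+* ℂ} (hτ : τ ≠ Complex.ofRealHom.comp ι) :
    InfinitePlace.mk τ ≠ primeOne ι := by
  intro h
  rcases InfinitePlace.mk_eq_iff.1 h with h | h
  · exact hτ h
  · refine hτ ?_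
    rw [← star_star τ]
    change star (ComplexEmbedding.conjugate τ) = _
    rw [h]
    ext x
    simp

open Classical in
/-- Multiplication by `α` contracts the representation space: the Pisot property gives this at the
infinite places other than `𝔭₁`, and the choice of the finite places gives it there. -/
theorem norm_phi_lt_one [Fintype (FinPrime α)] (hP : IsPisot (ι α))
    (hK : IntermediateField.adjoin ℚ {α} = ⊤) : ‖phi ι α α‖ < 1 := by
  refine max_lt (max_lt ?_ ?_) ?_
  · refine (pi_norm_lt_iff one_pos).2 fun w => ?_
    have := norm_embedding_lt_one hP hK (embedding_ne_of_ne_primeOne w.2.2)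
    rwa [← InfinitePlace.embedding_of_isReal_apply w.2.1, Complex.norm_real] at this
  · exact (pi_norm_lt_iff one_pos).2 fun w =>
      norm_embedding_lt_one hP hK (embedding_ne_of_ne_primeOne (ne_primeOne_of_isComplex w.2))
  · refine (pi_norm_lt_iff one_pos).2 fun p => ?_
    change ‖FinitePlace.embedding p.1 α‖ < 1
    rw [FinitePlace.norm_embedding', ← NNReal.coe_one, NNReal.coe_lt_coe,
      WithZeroMulInt.toNNReal_lt_one_iff (HeightOneSpectrum.one_lt_absNorm_nnreal p.1)]
    exact p.2

end Space


/-! ### The integers of the numeration system -/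

section Integers

variable {A K : Type*} [Fintype A] [DecidableEq A] [Field K] {σ : A → List A} {ι : K →+* ℝ} {α : K}
  {v : A → K}

/-- The sums `∑_{i<k} δ(p_i) α^i` over the walks of length `k` that end at `a`, in `K`. -/
abbrev intSums (σ : A → List A) (α : K) (v : A → K) : ℕ → A → Set K :=
  sums σ (AddMonoidHom.mulLeft α) (delta v)

omit [Fintype A] [DecidableEq A] in
theorem ne_zero_of_one_lt_map (hα : 1 < ι α) : α ≠ 0 := by
  rintro rfl
  rw [map_zero] at hα
  linarith

/-- The elements of `K` that are a sum over a walk to `a` of length `k`, for all large `k`. -/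
def integers (σ : A → List A) (α : K) (v : A → K) (a : A) : Set K :=
  {x | ∀ᶠ k in atTop, x ∈ intSums σ α v k a}

theorem delta_nil : delta v [] = 0 := by simp [delta, abel]

theorem approxIntegers_eq (hα : α ≠ 0) (a : A) (k : ℕ) :
    approxIntegers σ ι α v a k = ι '' intSums σ α v k a := by
  have hα' : ι α ≠ 0 := (map_ne_zero ι).2 hα
  have key := image_iterate_eq_image_walkSums (σ := σ) (f := AddMonoidHom.mulLeft α) (d := delta v)
    (m := AddMonoidHom.mulLeft (ι α)) (mInv := fun y => (ι α)⁻¹ * y)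
    (fun y => by simp [hα']) ι.toAddMonoidHom (fun x => by simp) (step := dtInv σ ι α v)
    (fun S => rfl) a k
  have hpow : ∀ y : ℝ, (AddMonoidHom.mulLeft (ι α))^[k] y = ι α ^ k * y := fun y => by
    rw [AddMonoidHom.coe_mulLeft, mul_left_iterate]
  have := congrArg (Prod.fst '' ·) key
  simp only [Set.image_image, hpow] at this
  rw [intSums, sums, Set.image_image]
  refine Eq.trans ?_ this
  ext x
  simp only [approxIntegers, Set.mem_image, Set.mem_ofPred_eq, eq_comm]

theorem delta_pos (hvpos : ∀ i, 0 < ι (v i)) : ∃ m > 0, ∀ p ≠ [], m ≤ ι (delta v p) := by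
  by_cases hA : Nonempty A
  · obtain ⟨i₀, hi₀⟩ := Finite.exists_min fun i => ι (v i)
    refine ⟨ι (v i₀), hvpos i₀, fun p hp => ?_⟩
    obtain ⟨j, hj⟩ := List.exists_mem_of_ne_nil p hp
    have h1 : (1 : ℝ) ≤ (p.count j : ℝ) := by exact_mod_cast List.count_pos_iff.2 hj
    calc ι (v i₀) ≤ ι (v j) := hi₀ j
      _ ≤ p.count j * ι (v j) := le_mul_of_one_le_left (hvpos j).le h1
      _ ≤ ∑ i, p.count i * ι (v i) := Finset.single_le_sum
          (f := fun i => (p.count i : ℝ) * ι (v i))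
          (fun i _ => mul_nonneg (Nat.cast_nonneg _) (hvpos i).le) (Finset.mem_univ j)
      _ = ι (delta v p) := by simp [delta, abel]
  · rw [not_nonempty_iff] at hA
    exact ⟨1, one_pos, fun p hp => absurd (List.eq_nil_iff_forall_not_mem.2 fun a => hA.elim a) hp⟩

theorem intSums_nonneg (hα : 0 < ι α) (hvpos : ∀ i, 0 < ι (v i)) (k : ℕ) (a : A) :
    ∀ x ∈ intSums σ α v k a, 0 ≤ ι x := by
  induction k generalizing a with
  | zero =>
    intro x hx
    rw [intSums, sums_zero, Set.mem_singleton_iff] at hx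
    simp [hx]
  | succ k ih =>
    intro x hx
    rw [intSums, sums_succ] at hx
    obtain ⟨b, p, e, y, hy, rfl⟩ := hx
    have h1 : 0 ≤ ι (delta v p) := by
      rw [delta, map_sum]
      exact Finset.sum_nonneg fun i _ => by
        rw [map_mul, map_natCast]
        exact mul_nonneg (Nat.cast_nonneg _) (hvpos i).le
    rw [AddMonoidHom.coe_mulLeft, map_add, map_mul]
    exact add_nonneg (mul_nonneg hα.le (ih b y hy)) h1

/-- Prolonging a long walk at its start adds `0` or a large number. -/
theorem eventually_intSums_decreasing (hα : 1 < ι α) (hvpos : ∀ i, 0 < ι (v i)) (a : A) (R : ℝ) :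
    ∀ᶠ k in atTop, ∀ x ∈ intSums σ α v (k + 1) a, ι x < R → x ∈ intSums σ α v k a := by
  obtain ⟨m, hm, hm'⟩ := delta_pos hvpos
  have hlim := (tendsto_pow_atTop_atTop_of_one_lt hα).atTop_mul_const hm
  filter_upwards [hlim.eventually_ge_atTop R] with k hk
  rintro _ ⟨⟨x, b⟩, ⟨⟨r, c⟩, hr, p, e, hx⟩, rfl⟩ hxR
  have hx' : x = r + α ^ k * delta v p := by
    rw [AddMonoidHom.coe_mulLeft, mul_left_iterate] at hx
    exact hx
  by_cases hp : p = []
  · refine ⟨_, hr, ?_⟩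
    simp [hx', hp, delta_nil]
  · have h1 := intSums_nonneg (zero_lt_one.trans hα) hvpos k a r ⟨_, hr, rfl⟩
    have h2 : ι α ^ k * m ≤ ι α ^ k * ι (delta v p) :=
      mul_le_mul_of_nonneg_left (hm' p hp) (pow_nonneg (zero_lt_one.trans hα).le k)
    simp only [hx', map_add, map_mul, map_pow] at hxR
    linarith

theorem isIntegers_image (hα : 1 < ι α) (hvpos : ∀ i, 0 < ι (v i)) (a : A) :
    IsIntegers σ ι α v a (ι '' integers σ α v a) := by
  have hα0 : α ≠ 0 := ne_zero_of_one_lt_map hα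
  have heq : approxIntegers σ ι α v a = fun k => ι '' intSums σ α v k a :=
    funext fun k => approxIntegers_eq hα0 a k
  have hlim := isTopologicalLimit_eventually (S := fun k => ι '' intSums σ α v k a)
    (fun k => (finite_sums k a).image ι) fun R => by
      filter_upwards [eventually_intSums_decreasing hα hvpos a R] with k hk
      rintro _ ⟨x, hx, rfl⟩ hxR
      exact ⟨x, hk x hx hxR, rfl⟩
  rw [IsIntegers, heq]
  convert hlim using 1
  ext x
  constructor
  · rintro ⟨y, hy, rfl⟩
    exact hy.mono fun k hk => ⟨y, hk, rfl⟩
  · intro hx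
    obtain ⟨k, y, hy, rfl⟩ := (id hx : ∀ᶠ k in atTop, x ∈ ι '' intSums σ α v k a).exists
    exact ⟨y, Eventually.mono hx fun k hk => ι.injective.mem_set_image.1 hk, rfl⟩

/-- An element of infinitely many of the sets of walk sums is an integer. -/
theorem mem_integers_of_frequently (hα : 1 < ι α) (hvpos : ∀ i, 0 < ι (v i)) {a : A} {x : K}
    (hx : ∃ᶠ k in atTop, x ∈ intSums σ α v k a) : x ∈ integers σ α v a := by
  have hα0 : α ≠ 0 := ne_zero_of_one_lt_map hα
  have : ι x ∈ ι '' integers σ α v a := by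
    rw [(isIntegers_image hα hvpos a).2]
    intro U hU
    refine hx.mono fun k hk => ⟨ι x, mem_of_mem_nhds hU, ?_⟩
    rw [approxIntegers_eq hα0]
    exact ⟨x, hk, rfl⟩
  exact ι.injective.mem_set_image.1 this

theorem gifs_integers (hα : 1 < ι α) (hvpos : ∀ i, 0 < ι (v i)) :
    gifs σ (AddMonoidHom.mulLeft α) (delta v) (integers σ α v) = integers σ α v := by
  have hα0 : α ≠ 0 := ne_zero_of_one_lt_map hα
  ext a z
  have hshift : z ∈ integers σ α v a ↔
      ∀ᶠ k in atTop, z ∈ gifs σ (AddMonoidHom.mulLeft α) (delta v) (intSums σ α v k) a := by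
    simp only [← sums_succ]
    change (∀ᶠ k in atTop, z ∈ intSums σ α v k a) ↔ _
    conv_lhs => rw [← map_add_atTop_eq_nat 1]
    rfl
  constructor
  · rintro ⟨b, p, e, y, hy, rfl⟩
    exact hshift.2 (Eventually.mono hy fun k hk => ⟨b, p, e, y, hk, rfl⟩)
  · intro hz
    have hz' := hshift.1 hz
    by_contra hcon
    -- by finiteness of the set of edges, some last edge serves infinitely many lengths
    have hnone : ∀ᶠ k in atTop, ∀ b, ∀ p ∈ {p | ∃ a, Edge σ b p a}, Edge σ b p a →
        α⁻¹ * (z - delta v p) ∉ intSums σ α v k b := by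
      rw [eventually_all]
      intro b
      rw [eventually_all_finite (finite_edge_labels σ b)]
      intro p _
      by_cases e : Edge σ b p a
      · simp only [e, true_imp_iff]
        by_contra hfreq
        refine hcon ⟨b, p, e, _, mem_integers_of_frequently hα hvpos hfreq, ?_⟩
        simp [hα0]
      · simp [e]
    obtain ⟨k, ⟨b, p, e, y, hy, rfl⟩, hk⟩ := (hz'.and hnone).exists
    refine hk b p ⟨a, e⟩ e ?_
    simpa [hα0] using hy

/-- Every letter is the end of infinitely many walks with the same sum: take walks with empty
prefixes from a fixed letter up to a letter that is met infinitely often, and prolong them by a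
walk to the given letter. -/
theorem integers_nonempty [Algebra ℚ K] (hσ : ∀ a, σ a ≠ [])
    (hirr : Irreducible (incidence ℚ σ).charpoly) (hv : v ᵥ* incidence K σ = α • v)
    (hα : 1 < ι α) (hvpos : ∀ i, 0 < ι (v i)) (a : A) : (integers σ α v a).Nonempty := by
  let g : A → A := fun b => (σ b).head (hσ b)
  have hg : ∀ b, Edge σ b [] (g b) := fun b => ⟨(σ b).tail, by simp [g]⟩
  obtain ⟨c, hc⟩ := Finite.exists_infinite_fiber fun j : ℕ => g^[j] a
  have hv0 : ∀ i, v i ≠ 0 := fun i h => by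
    have := hvpos i
    rw [h, map_zero] at this
    exact this.false
  have hreach := eq_univ_of_closed hirr hv hv0
    (S := {a | ∃ l x, (x, c) ∈ walkSums σ (AddMonoidHom.mulLeft α) (delta v) a l})
    ⟨c, 0, 0, rfl⟩ fun b hb a' ha' => by
      obtain ⟨l, x, hx⟩ := hb
      obtain ⟨p, e⟩ := exists_edge_iff_mem.2 ha'
      exact ⟨l + 1, _, mem_walkSums_succ.2 ⟨b, p, x, e, hx, rfl⟩⟩
  obtain ⟨l, x, hx⟩ := hreach.superset (Set.mem_univ a)
  refine ⟨x, mem_integers_of_frequently hα hvpos (frequently_atTop.2 fun N => ?_)⟩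
  obtain ⟨j, hj, hNj⟩ := (Set.infinite_coe_iff.1 hc).exists_gt N
  refine ⟨l + j, by omega, (x, a), walkSums_prolong delta_nil hg j a ?_, rfl⟩
  rw [show g^[j] a = c from hj]
  exact hx

end Integers

/-! ### Dual prototiles -/

section Prototiles

variable {A K : Type*} [Fintype A] [DecidableEq A] [Field K] [NumberField K] {σ : A → List A}
  {ι : K →+* ℝ} {α : K} {v : A → K}

theorem image_phi_gifs (S : A → Set K) :
    gifs σ (AddMonoidHom.mulLeft (phi ι α α)) (fun p => phi ι α (delta v p))
        (fun a => phi ι α '' S a) =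
      fun a => phi ι α '' gifs σ (AddMonoidHom.mulLeft α) (delta v) S a :=
  gifs_image (phiHom ι α).toAddMonoidHom (fun x => map_mul (phiHom ι α) α x) (fun _ => rfl) S

theorem sums_phi (k : ℕ) :
    sums σ (AddMonoidHom.mulLeft (phi ι α α)) (fun p => phi ι α (delta v p)) k =
      fun a => phi ι α '' intSums σ α v k a :=
  sums_map (phiHom ι α).toAddMonoidHom (fun x => map_mul (phiHom ι α) α x) (fun _ => rfl) k

/-- The closures of the images of the integers are the unique dual prototiles, and the images of
the walk sums converge to them. -/
theorem isDualPrototile_closure (hσ : IsIrreduciblePisot σ (ι α))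
    (hK : IntermediateField.adjoin ℚ {α} = ⊤) (hv : v ᵥ* incidence K σ = α • v)
    (hvpos : ∀ i, 0 < ι (v i)) :
    IsDualPrototile σ ι α v (fun a => closure (phi ι α '' integers σ α v a)) ∧
    (∀ Ω, IsDualPrototile σ ι α v Ω → Ω = fun a => closure (phi ι α '' integers σ α v a)) ∧
    ∀ a, IsHausdorffLimit (fun k => phi ι α '' intSums σ α v k a)
      (closure (phi ι α '' integers σ α v a)) := by
  classical
  have hα : 1 < ι α := hσ.isPisot.2.1
  have hα0 : α ≠ 0 := ne_zero_of_one_lt_map hα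
  have := finite_finPrime hα0
  let _ : Fintype (FinPrime α) := Fintype.ofFinite _
  have hc1 := norm_phi_lt_one hσ.isPisot hK
  have hc := norm_nonneg (phi ι α α)
  have hf : ∀ x : RepSpace ι α,
      ‖AddMonoidHom.mulLeft (phi ι α α) x‖ ≤ ‖phi ι α α‖ * ‖x‖ := fun x => norm_mul_le _ _
  obtain ⟨B, hB⟩ := exists_forall_sums_norm_le (σ := σ) (d := fun p => phi ι α (delta v p))
    hc hc1 hf
  have hbdd : ∀ a, Bornology.IsBounded (phi ι α '' integers σ α v a) := fun a => by
    refine isBounded_iff_forall_norm_le.2 ⟨B, ?_⟩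
    rintro _ ⟨x, hx, rfl⟩
    obtain ⟨k, hk⟩ := Eventually.exists hx
    exact hB k a _ (by rw [sums_phi]; exact ⟨x, hk, rfl⟩)
  have hfix := image_phi_gifs (σ := σ) (ι := ι) (α := α) (v := v) (integers σ α v)
  rw [gifs_integers hα hvpos] at hfix
  obtain ⟨h1, h2⟩ := gifs_closure hc hc1 hf hbdd hfix
  have hne : ∀ a, (closure (phi ι α '' integers σ α v a)).Nonempty := fun a =>
    ((integers_nonempty hσ.isSubstitution.1 hσ.irreducible hv hα hvpos a).image _).closure
  have hne' := fun a => And.intro (hne a) (h1 a)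
  refine ⟨⟨hne', h2⟩, fun Ω hΩ => ?_, fun a => ?_⟩
  · refine gifs_fixed_unique hc hc1 (fun x y => ?_) hΩ.1 hne' hΩ.2 h2
    rw [dist_eq_norm, dist_eq_norm, ← mul_sub]
    exact norm_mul_le _ _
  · have := isHausdorffLimit_sums hc hc1 hf hne' h2 a
    simpa only [sums_phi] using this

end Prototiles

/-! ### The hyperplane and the representation space -/

section Hyperplane

variable {A K : Type*} [Fintype A] [DecidableEq A] [Field K] [NumberField K] {σ : A → List A}
  {ι : K →+* ℝ} {α : K} {v : A → K} {u : A → ℝ}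

omit [DecidableEq A] [NumberField K] in
theorem sum_smul_phiInf_eq_zero_iff {x : A → ℝ} :
    ∑ i, x i • phiInf ι (v i) = 0 ↔
      ∀ w : InfinitePlace K, w ≠ primeOne ι → ∑ i, (x i : ℂ) * w.embedding (v i) = 0 := by
  have hreal : ∀ w : {w : InfinitePlace K // w.IsReal ∧ w ≠ primeOne ι},
      (∑ i, x i • phiInf ι (v i)).1 w = 0 ↔ ∑ i, (x i : ℂ) * w.1.embedding (v i) = 0 := by
    intro w
    rw [← Complex.ofReal_eq_zero]
    simp [Prod.fst_sum, Finset.sum_apply, phiInf]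
  have hcomp : ∀ w : {w : InfinitePlace K // w.IsComplex},
      (∑ i, x i • phiInf ι (v i)).2 w = ∑ i, (x i : ℂ) * w.1.embedding (v i) := by
    intro w
    simp [Prod.snd_sum, Finset.sum_apply, phiInf]
  constructor
  · intro h w hw
    rcases w.isReal_or_isComplex with hr | hc
    · exact (hreal ⟨w, hr, hw⟩).1 (by rw [h]; rfl)
    · rw [← hcomp ⟨w, hc⟩, h]
      rfl
  · intro h
    refine Prod.ext (funext fun w => (hreal w).2 (h w.1 w.2.2)) (funext fun w => ?_)
    rw [hcomp, h w.1 (ne_primeOne_of_isComplex w.2)]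
    rfl

/-- The archimedean part of `G` is injective on the hyperplane orthogonal to `v`. -/
theorem eq_zero_of_sum_smul_phiInf (hirr : Irreducible (incidence ℚ σ).charpoly)
    (hK : IntermediateField.adjoin ℚ {α} = ⊤) (hv : v ᵥ* incidence K σ = α • v) (hv0 : v ≠ 0)
    {x : A → ℝ} (h1 : ∑ i, x i * ι (v i) = 0) (h2 : ∑ i, x i • phiInf ι (v i) = 0) : x = 0 := by
  rw [sum_smul_phiInf_eq_zero_iff] at h2
  have hx : (fun i => (x i : ℂ)) = 0 := by
    refine eq_zero_of_forall_embedding hirr hK hv hv0 fun τ => ?_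
    by_cases hτ : τ = Complex.ofRealHom.comp ι
    · rw [hτ]
      simpa using congrArg (Complex.ofReal) h1
    · have h3 := h2 _ (embedding_mk_ne hτ)
      rcases InfinitePlace.embedding_mk_eq τ with h | h
      · rwa [h] at h3
      · rw [h] at h3
        have := congrArg (starRingEnd ℂ) h3
        simpa [ComplexEmbedding.conjugate_coe_eq] using this
  ext i
  exact Complex.ofReal_eq_zero.1 (congrFun hx i)

/-- The projection along `u` does not affect the infinite places other than `𝔭₁`. -/
theorem sum_smul_phiInf_right_eigenvector (hK : IntermediateField.adjoin ℚ {α} = ⊤)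
    (hv : v ᵥ* incidence K σ = α • v) (hu : incidence ℝ σ *ᵥ u = ι α • u) :
    ∑ i, u i • phiInf ι (v i) = 0 := by
  rw [sum_smul_phiInf_eq_zero_iff]
  intro w hw
  exact sum_mul_embedding_eq_zero Complex.ofRealHom hv hu fun h =>
    embedding_ne_of_ne_primeOne hw (embedding_apply_injective hK h)

/-- The pairing `x ↦ ⟨x, v⟩` on `ℚⁿ`. -/
def pairing (v : A → K) : (A → ℚ) →+ K where
  toFun x := ∑ i, (x i : K) * v i
  map_zero' := by simp
  map_add' x y := by simp [add_mul, Finset.sum_add_distrib]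

theorem pairing_mulVec (hv : v ᵥ* incidence K σ = α • v) (x : A → ℚ) :
    pairing v (incidence ℚ σ *ᵥ x) = α * pairing v x := by
  have h : ∀ y : A → ℚ, pairing v y = v ⬝ᵥ (fun i => (y i : K)) := fun y =>
    Finset.sum_congr rfl fun i _ => mul_comm _ _
  have h' : (fun i => ((incidence ℚ σ *ᵥ x) i : K)) = incidence K σ *ᵥ fun i => (x i : K) := by
    ext i
    simp [Matrix.mulVec, dotProduct, incidence]
  rw [h, h, h', Matrix.dotProduct_mulVec, hv, smul_dotProduct, smul_eq_mul]

theorem gMap_projU_psi (hK : IntermediateField.adjoin ℚ {α} = ⊤)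
    (hv : v ᵥ* incidence K σ = α • v) (hu : incidence ℝ σ *ᵥ u = ι α • u) (x : A → ℚ) :
    gMap ι α v (projU ι α v u (psi α v x)) = phi ι α (pairing v x) := by
  refine Prod.ext ?_ rfl
  have hrat : ∀ (q : ℚ) (y : K), (q : ℝ) • phiInf ι y = phiInf ι (q * y) := fun q y =>
    Prod.ext (funext fun w => by simp [phiInf]) (funext fun w => by simp [phiInf])
  have hsum : ∑ i, phiInf ι ((x i : K) * v i) = phiInf ι (pairing v x) :=
    (map_sum ((AddMonoidHom.fst _ _).comp (phiHom ι α).toAddMonoidHom) _ _).symm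
  change ∑ i, ((x i : ℝ) - (∑ j, (x j : ℝ) * ι (v j)) * u i) • phiInf ι (v i) = _
  simp only [sub_smul, mul_smul, Finset.sum_sub_distrib, ← Finset.smul_sum,
    sum_smul_phiInf_right_eigenvector hK hv hu, smul_zero, sub_zero, hrat]
  exact hsum

omit [DecidableEq A] in
theorem projU_mem_hyperplane (huv : ∑ i, u i * ι (v i) = 1) (z : ZExt A α) :
    ∑ i, (projU ι α v u z).1 i * ι (v i) = 0 := by
  simp only [projU, sub_mul, Finset.sum_sub_distrib, mul_assoc, ← Finset.mul_sum, huv, mul_one,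
    sub_self]

/-- A uniformly continuous left inverse of `G` on the product of the hyperplane orthogonal to `v`
and the finite part. -/
theorem exists_gMap_leftInverse (hirr : Irreducible (incidence ℚ σ).charpoly)
    (hK : IntermediateField.adjoin ℚ {α} = ⊤) (hv : v ᵥ* incidence K σ = α • v) (hv0 : v ≠ 0) :
    ∃ H : RepSpace ι α → RExt A α, UniformContinuous H ∧
      ∀ z : RExt A α, ∑ i, z.1 i * ι (v i) = 0 → H (gMap ι α v z) = z := by
  classical
  let P : Submodule ℝ (A → ℝ) := LinearMap.ker (Fintype.linearCombination ℝ fun i => ι (v i))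
  let L : P →ₗ[ℝ] InfPart ι := (Fintype.linearCombination ℝ fun i => phiInf ι (v i)).comp P.subtype
  have hP : ∀ x : A → ℝ, x ∈ P ↔ ∑ i, x i * ι (v i) = 0 := fun x => Iff.rfl
  have hL : LinearMap.ker L = ⊥ := by
    refine LinearMap.ker_eq_bot'.2 fun x hx => Subtype.ext ?_
    refine eq_zero_of_sum_smul_phiInf (ι := ι) hirr hK hv hv0 ?_ ?_
    · exact (hP _).1 x.2
    · simpa [L, Fintype.linearCombination_apply] using hx
  obtain ⟨g, hg⟩ := L.exists_leftInverse_of_injective hL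
  refine ⟨Prod.map (fun y => (g y : A → ℝ)) id, ?_, fun z hz => ?_⟩
  · exact (LinearMap.toContinuousLinearMap (P.subtype.comp g)).uniformContinuous.prodMap
      uniformContinuous_id
  · have hLz : L ⟨z.1, (hP _).2 hz⟩ = (gMap ι α v z).1 := rfl
    refine Prod.ext ?_ rfl
    have := congrArg Subtype.val (LinearMap.congr_fun hg ⟨z.1, (hP _).2 hz⟩)
    rwa [LinearMap.comp_apply, hLz] at this

omit [DecidableEq A] in
theorem continuous_gMap : Continuous (gMap ι α v : RExt A α → RepSpace ι α) := by
  unfold gMap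
  fun_prop

end Hyperplane

/-! ### Subtiles of the dual map -/

section Subtiles

variable {A K : Type*} [Fintype A] [DecidableEq A] [Field K] [NumberField K] {σ : A → List A}
  {ι : K →+* ℝ} {α : K} {v : A → K} {u : A → ℝ}

theorem approxSubtile_eq (hdet : (incidence ℚ σ).det ≠ 0) (hα : α ≠ 0)
    (hv : v ᵥ* incidence K σ = α • v) (a : A) (k : ℕ) :
    approxSubtile σ ι α v u a k = (fun x => projU ι α v u (psi α v x)) ''
      sums σ (incidence ℚ σ).mulVecLin.toAddMonoidHom (fun p i => (abel p i : ℚ)) k a := by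
  let m : ZExt A α →+ ZExt A α :=
    (incidence ℚ σ).mulVecLin.toAddMonoidHom.prodMap (AddMonoidHom.mulLeft (phiFin α α))
  let e : (A → ℚ) →+ ZExt A α := (AddMonoidHom.id _).prod
    ((AddMonoidHom.snd _ _).comp ((phiHom ι α).toAddMonoidHom.comp (pairing v)))
  have hphi : ∀ x y : K, phiFin α (x * y) = phiFin α x * phiFin α y := fun x y =>
    congrArg Prod.snd (map_mul (phiHom ι α) x y)
  have hone : phiFin α (1 : K) = 1 := congrArg Prod.snd (map_one (phiHom ι α))
  have key := image_iterate_eq_image_walkSums (σ := σ)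
    (f := (incidence ℚ σ).mulVecLin.toAddMonoidHom) (d := fun p i => (abel p i : ℚ))
    (m := m) (mInv := mExtInv σ α) (fun y => ?_) e (fun x => ?_)
    (step := eOneStar σ α v) (fun S => rfl) a k
  · have := congrArg (fun S => (fun q : ZExt A α × A => projU ι α v u q.1) '' S) key
    simp only [Set.image_image] at this
    rw [sums, Set.image_image]
    refine Eq.trans ?_ this
    ext x
    simp only [approxSubtile, Set.mem_image, Set.mem_ofPred_eq, eq_comm]
    rfl
  · refine Prod.ext ?_ ?_
    · change incidence ℚ σ *ᵥ ((incidence ℚ σ)⁻¹ *ᵥ y.1) = y.1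
      rw [Matrix.mulVec_mulVec, Matrix.mul_nonsing_inv _ (isUnit_iff_ne_zero.2 hdet),
        Matrix.one_mulVec]
    · change phiFin α α * (phiFin α α⁻¹ * y.2) = y.2
      rw [← mul_assoc, ← hphi, mul_inv_cancel₀ hα, hone, one_mul]
  · refine Prod.ext rfl ?_
    change phiFin α (pairing v (incidence ℚ σ *ᵥ x)) = phiFin α α * phiFin α (pairing v x)
    rw [pairing_mulVec hv, hphi]

theorem intSums_eq_image_pairing (hv : v ᵥ* incidence K σ = α • v) (k : ℕ) (a : A) :
    intSums σ α v k a = pairing v ''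
      sums σ (incidence ℚ σ).mulVecLin.toAddMonoidHom (fun p i => (abel p i : ℚ)) k a :=
  congrFun (sums_map (pairing v) (fun x => pairing_mulVec hv x)
    (fun p => by simp [pairing, delta]) k) a

end Subtiles

end Rauzy

theorem mainTheorem1 {A K : Type*} [Fintype A] [DecidableEq A] [Field K] [NumberField K]
    (σ : A → List A) (ι : K →+* ℝ) (α : K)
    -- `σ` is an irreducible Pisot substitution, `K = ℚ(α)`, and `α` is its Pisot root
    (hσ : IsIrreduciblePisot σ (ι α)) (hK : IntermediateField.adjoin ℚ {α} = ⊤)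
    -- a positive left eigenvector with entries in `K`
    (v : A → K) (hv : v ᵥ* incidence K σ = α • v) (hvpos : ∀ i, 0 < ι (v i))
    -- the right eigenvector with `⟨u, v⟩ = 1`
    (u : A → ℝ) (hu : incidence ℝ σ *ᵥ u = ι α • u) (huv : ∑ i, u i * ι (v i) = 1) :
    -- the `(σ, a)`-integers, the dual prototiles and the `E₁^*`-subtiles are well defined
    (∀ a, ∃! Z, IsIntegers σ ι α v a Z) ∧
    (∃! Ω, IsDualPrototile σ ι α v Ω) ∧
    (∀ a, ∃! T, IsEOneStarSubtile σ ι α v u a T) ∧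
    -- and the three kinds of subtiles coincide
    ∀ (Z : A → Set ℝ) (Ω : A → Set (RepSpace ι α)) (T : A → Set (RExt A α)),
      (∀ a, IsIntegers σ ι α v a (Z a)) → IsDualPrototile σ ι α v Ω →
      (∀ a, IsEOneStarSubtile σ ι α v u a (T a)) →
      ∀ a, Z a ⊆ Set.range ι ∧ dtSubtile ι α (Z a) = Ω a ∧ Ω a = gMap ι α v '' T a := by
  have hα : 1 < ι α := hσ.isPisot.2.1
  have hα0 : α ≠ 0 := ne_zero_of_one_lt_map hα
  have hv0 : v ≠ 0 := by
    obtain ⟨i⟩ := nonempty_of_irreducible_charpoly hσ.irreducible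
    intro h
    have := hvpos i
    rw [h, Pi.zero_apply, map_zero] at this
    exact this.false
  have hdet := incidence_det_ne_zero hσ.irreducible hv hv0 hα0
  have hZ := fun a => isIntegers_image (σ := σ) hα hvpos a
  obtain ⟨hΩ, hΩu, hlim⟩ := isDualPrototile_closure hσ hK hv hvpos
  obtain ⟨H, hH, hHG⟩ := exists_gMap_leftInverse (ι := ι) hσ.irreducible hK hv hv0
  have hHphi : ∀ x : A → ℚ, H (phi ι α (pairing v x)) = projU ι α v u (psi α v x) := fun x => by
    rw [← gMap_projU_psi hK hv hu, hHG _ (projU_mem_hyperplane huv _)]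
  have happrox : ∀ a, approxSubtile σ ι α v u a = fun k => H '' (phi ι α '' intSums σ α v k a) :=
    fun a => funext fun k => by
      rw [approxSubtile_eq hdet hα0 hv, intSums_eq_image_pairing hv, Set.image_image,
        Set.image_image]
      exact Set.image_congr fun x _ => (hHphi x).symm
  have hT : ∀ a, IsEOneStarSubtile σ ι α v u a (H '' closure (phi ι α '' integers σ α v a)) :=
    fun a => by
      rw [IsEOneStarSubtile, happrox]
      exact (hlim a).image hH
  have hGT : ∀ a, gMap ι α v '' (H '' closure (phi ι α '' integers σ α v a)) =
      closure (phi ι α '' integers σ α v a) := fun a => by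
    have hcl : IsClosed {z | gMap ι α v (H z) = z} :=
      isClosed_eq (continuous_gMap.comp hH.continuous) continuous_id
    have hsub : closure (phi ι α '' integers σ α v a) ⊆ {z | gMap ι α v (H z) = z} := by
      refine closure_minimal ?_ hcl
      rintro _ ⟨y, hy, rfl⟩
      obtain ⟨k, hk⟩ := Eventually.exists hy
      rw [intSums_eq_image_pairing hv] at hk
      obtain ⟨x, -, rfl⟩ := hk
      rw [Set.mem_ofPred_eq, hHphi, gMap_projU_psi hK hv hu]
    rw [Set.image_image, Set.image_congr fun z hz => hsub hz, Set.image_id']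
  refine ⟨fun a => ⟨_, hZ a, fun Z h => h.1.trans (hZ a).1.symm⟩, ⟨_, hΩ, hΩu⟩,
    fun a => ⟨_, hT a, fun T h => IsHausdorffLimit.unique h (hT a)⟩, ?_⟩
  intro Z Ω T hZ' hΩ' hT' a
  rw [(hZ' a).1.trans (hZ a).1.symm, hΩu Ω hΩ', IsHausdorffLimit.unique (hT' a) (hT a), hGT]
  refine ⟨Set.image_subset_range _ _, ?_, rfl⟩
  have : {x | ι x ∈ ι '' integers σ α v a} = integers σ α v a :=
    Set.preimage_image_eq _ ι.injective
  rw [dtSubtile, this]
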